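/- Fix a real number $L>0$. Let $\mathcal P_+=\coprod_{N\ge 1}\mathcal P_{+,N}$, where $\mathcal P_{+,N}$ is the set of sequences $(x_1,\dots,x_{2N})$ of positive real numbers with $\sum_{i=1}^{2N}x_i\le L$ that satisfy the highest weight condition $\sum_{i=1}^k(x_{2i-1}-x_{2i})\ge 0$ for $1\le k\le N$. Let $\mathcal M=\coprod_{s\ge1}\mathcal M_s$, where $\mathcal M_s$ is the set of sequences $\lambda=(l_j,m_j)_{1\le j\le s}$ with $l_j\in\mathbb R_{>0}$, $m_j\in\mathbb Z_{>0}$, $l_1>\dots>l_s$ and $\sum_{j=1}^s l_jm_j\le L/2$ (real Young diagrams of area at most $L/2$). For $\lambda\in\mathcal M_s$ put $p_j(\lambda)=L-2\sum_{k=1}^s\min(l_j,l_k)m_k$, and let $\mathrm{Rig}(\lambda)$ be the set of families of reals $(J^{(j)}_i)_{1\le i\le m_j,\,1\le j\le s}$ with $0\le J^{(j)}_1\le\dots\le J^{(j)}_{m_j}\le p_j(\lambda)$ for all $j$. Define a map $\phi$ on $\mathcal P_+$ as follows. Given $x\in\mathcal P_{+,N}$, put $x^{(1)}=x$ and $N^{(1)}=N$.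 Given a nonempty sequence $x^{(i)}$ of $2N^{(i)}$ positive reals, let $\mu^{(i)}$ be its smallest entry and let $y^{(i)}_j=x^{(i)}_j-\mu^{(i)}$. Let $k^{(i)}$ be the number of maximal runs of consecutive zeros in $y^{(i)}$, and let the $j$th run from the left consist of $n^{(i)}_j\ge1$ zeros. The sequence $x^{(i+1)}$, of length $2N^{(i+1)}$, arises from $y^{(i)}$ by the following rules, in this order: (1) a run of zeros at the left end is removed; (2) a run of zeros between two positive entries $a,b$ is removed, and if its length is odd, then moreover $a,b$ are replaced by the single entry $a+b$; (3) a run of zeros at the right end is removed, and if its length is odd, then moreover the positive entry directly to the left of it (after the replacements in (2)) is removed. The procedure stops after step $i=s$ if $x^{(s+1)}$ is empty. Put $\nu^{(i)}=N^{(i)}-N^{(i+1)}$, and let $r^{(i)}_j$ be the sum of all entries of $y^{(i)}$ to the left of its $j$th run of zeros. Then $\phi(x)=(\phi_1(x),\phi_2(x))$, where $\phi_1(x)=(l_j,m_j)_{1\le j\le s}$ is given by $$l_{s+1-i}=\mu^{(1)}+\dots+\mu^{(i)},\qquad m_{s+1-i}=\nu^{(i)}\qquad(1\le i\le s),$$ and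 $\phi_2(x)=(J^{(j)}_i)$ is such that the sequence $J^{(s+1-i)}_1,J^{(s+1-i)}_2,\dots$ is the sequence in which $r^{(i)}_1$ is repeated $\lceil n^{(i)}_1/2\rceil$ times, then $r^{(i)}_2$ is repeated $\lceil n^{(i)}_2/2\rceil$ times, and so on up to $r^{(i)}_{k^{(i)}}$ repeated $\lceil n^{(i)}_{k^{(i)}}/2\rceil$ times. Theorem. The map $\phi$ is a bijection from $\mathcal P_+$ onto $\bigsqcup_{\lambda\in\mathcal M}\{\lambda\}\times\mathrm{Rig}(\lambda)$; in particular $\phi_1(x)\in\mathcal M$ and $\phi_2(x)\in\mathrm{Rig}(\phi_1(x))$ for every $x\in\mathcal P_+$. -/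

import Mathlib

/-!
Finite sequences are lists.  A sequence `x = (x_1, …, x_{2N})` is a `List ℝ` of length `2 * N`,
so the entry `x_i` is the list entry with index `i - 1`.
-/

namespace ContinuousKKR

noncomputable section

/-- Highest weight condition for a sequence of length `2 * n`:
`∑_{i=1}^k (x_{2i-1} - x_{2i}) ≥ 0` for `1 ≤ k ≤ n`. -/
def HighestWeight (n : ℕ) (x : List ℝ) : Prop :=
  ∀ k, 1 ≤ k → k ≤ n → 0 ≤ ∑ i ∈ Finset.range k, (x.getD (2 * i) 0 - x.getD (2 * i + 1) 0)

/-- Positive sequences of length `2 * N` with total sum at most `L` satisfying the highest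
weight condition. -/
def PathsN (L : ℝ) (N : ℕ) : Set (List ℝ) :=
  {x | x.length = 2 * N ∧ (∀ a ∈ x, 0 < a) ∧ x.sum ≤ L ∧ HighestWeight N x}

/-- The set `𝒫₊`, the disjoint union of the `PathsN L N` over `N ≥ 1`. -/
def Paths (L : ℝ) : Set (List ℝ) :=
  {x | ∃ N, 1 ≤ N ∧ x ∈ PathsN L N}

/-- The set `ℳ` of real Young diagrams `λ = (l_j, m_j)_{1 ≤ j ≤ s}`, `s ≥ 1`, with `l_j > 0`
real, `m_j > 0` an integer, `l_1 > ⋯ > l_s`, and area `∑ l_j m_j ≤ L / 2`. -/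
def Diagrams (L : ℝ) : Set (List (ℝ × ℕ)) :=
  {lam | 1 ≤ lam.length ∧ (∀ b ∈ lam, 0 < b.1 ∧ 0 < b.2) ∧
    lam.Pairwise (fun b c => b.1 > c.1) ∧ (lam.map fun b => b.1 * (b.2 : ℝ)).sum ≤ L / 2}

/-- The vacancy number `L - 2 ∑_k min(l, l_k) m_k` belonging to the row length `l`;
the `j`th vacancy number `p_j(λ)` is the case `l = l_j`. -/
def vacancy (L : ℝ) (lam : List (ℝ × ℕ)) (l : ℝ) : ℝ :=
  L - 2 * (lam.map fun b => min l b.1 * (b.2 : ℝ)).sum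

/-- The set `Rig(λ)`: for every `j` a weakly increasing sequence `J_1 ≤ ⋯ ≤ J_{m_j}` of
exactly `m_j` reals lying in `[0, p_j(λ)]`. -/
def Rig (L : ℝ) (lam : List (ℝ × ℕ)) : Set (List (List ℝ)) :=
  {J | List.Forall₂ (fun b K => K.length = b.2 ∧ K.Pairwise (· ≤ ·) ∧
    ∀ r ∈ K, 0 ≤ r ∧ r ≤ vacancy L lam b.1) lam J}

/-- The disjoint union of the sets `{λ} × Rig(λ)` over `λ ∈ ℳ`. -/
def RiggedDiagrams (L : ℝ) : Set (List (ℝ × ℕ) × List (List ℝ)) :=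
  {c | c.1 ∈ Diagrams L ∧ c.2 ∈ Rig L c.1}

/-- The smallest entry of a nonempty sequence. -/
def minEntry (x : List ℝ) : ℝ := x.minimum.untopD 0

/-- `y_j = x_j - μ`, where `μ` is the smallest entry. -/
def reduced (x : List ℝ) : List ℝ := x.map (fun a => a - minEntry x)

/-- Decomposition into runs of zeros: the value `(n₀, [(a₁, n₁), …, (a_p, n_p)])` means that the
sequence is `n₀` zeros, then the nonzero entry `a₁`, then `n₁` zeros, and so on up to `a_p`
followed by `n_p` zeros.  The (nonempty) runs of zeros are those with `n_i > 0`. -/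
def zeroRuns : List ℝ → ℕ × List (ℝ × ℕ)
  | [] => (0, [])
  | a :: y =>
    if a = 0 then ((zeroRuns y).1 + 1, (zeroRuns y).2)
    else (0, (a, (zeroRuns y).1) :: (zeroRuns y).2)

/-- Elimination of zeros from `a, 0^n` followed by the blocks `b, 0^m` of the list.
A run between two positive neighbours is removed, and the neighbours are joined into their sum
if the length of the run is odd; a run at the right end is removed, and together with it its
left neighbour if the length of the run is odd. -/
def contract (a : ℝ) (n : ℕ) : List (ℝ × ℕ) → List ℝ
  | [] => if Even n then [a] else []
  | (b, m) :: t => if Even n then a :: contract b m t else contract (a + b) m t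

/-- Elimination of zeros; a run at the left end is just removed. -/
def eliminate (y : List ℝ) : List ℝ :=
  match (zeroRuns y).2 with
  | [] => []
  | (a, n) :: t => contract a n t

/-- One step `x^{(i)} ↦ x^{(i+1)}` of the algorithm. -/
def next (x : List ℝ) : List ℝ := eliminate (reduced x)

/-- Quantum numbers coming from the blocks `a, 0^n` when the entries to the left sum up to `r`:
a run of `n` zeros contributes `⌈n / 2⌉ = (n + 1) / 2` copies of the sum of all entries to the
left of the run. -/
def quantumAux (r : ℝ) : List (ℝ × ℕ) → List ℝ
  | [] => []
  | (a, n) :: t => List.replicate ((n + 1) / 2) (r + a) ++ quantumAux (r + a) t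

/-- The quantum numbers of one step, read off from `y = reduced x`, from left to right. -/
def quantum (x : List ℝ) : List ℝ :=
  List.replicate (((zeroRuns (reduced x)).1 + 1) / 2) 0 ++
    quantumAux 0 (zeroRuns (reduced x)).2

theorem length_contract_le (t : List (ℝ × ℕ)) :
    ∀ (a : ℝ) (n : ℕ), (contract a n t).length ≤ t.length + 1 := by
  induction t with
  | nil => intro a n; unfold contract; split_ifs <;> simp
  | cons b t ih =>
    intro a n
    obtain ⟨b, m⟩ := b
    unfold contract
    split_ifs
    · simpa using ih b m
    · have := ih (a + b) m
      simp only [List.length_cons]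
      omega

theorem length_eliminate_le (y : List ℝ) :
    (eliminate y).length ≤ (zeroRuns y).2.length := by
  unfold eliminate
  split
  · simp
  · next h => rw [h]; exact length_contract_le _ _ _

theorem length_zeroRuns_le (y : List ℝ) : (zeroRuns y).2.length ≤ y.length := by
  induction y with
  | nil => simp [zeroRuns]
  | cons a y ih =>
    unfold zeroRuns
    split_ifs
    · simp only [List.length_cons]; omega
    · simpa using ih

theorem length_zeroRuns_lt (y : List ℝ) (h : (0 : ℝ) ∈ y) :
    (zeroRuns y).2.length < y.length := by
  induction y with
  | nil => simp at h
  | cons a y ih =>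
    have h1 := length_zeroRuns_le y
    unfold zeroRuns
    split_ifs with ha
    · simp only [List.length_cons]; omega
    · have h2 : (0 : ℝ) ∈ y := by
        rcases List.mem_cons.1 h with h | h
        · exact absurd h.symm ha
        · exact h
      simpa using ih h2

theorem length_next_lt (x : List ℝ) (hx : x ≠ []) : (next x).length < x.length := by
  have hmem : minEntry x ∈ x := by
    obtain ⟨m, hm⟩ := WithTop.ne_top_iff_exists.1 (List.minimum_ne_top_of_ne_nil hx)
    have : minEntry x = m := by simp [minEntry, ← hm]
    rw [this]
    exact List.minimum_mem hm.symm
  have h0 : (0 : ℝ) ∈ reduced x := List.mem_map.2 ⟨_, hmem, sub_self _⟩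
  have h1 := length_zeroRuns_lt _ h0
  have h2 : (reduced x).length = x.length := by simp [reduced]
  have h3 := length_eliminate_le (reduced x)
  unfold next
  omega

/-- The sequences `[x^{(1)}, …, x^{(s)}]` produced by the algorithm from `x^{(1)} = x`;
it stops when the next sequence is empty. -/
def levels (x : List ℝ) : List (List ℝ) :=
  if h : x = [] then [] else x :: levels (next x)
termination_by x.length
decreasing_by exact length_next_lt x h

/-- The block `(μ, ν)` of a level: `μ` is the smallest entry and `ν` is the drop of half the
length. -/
def block (x : List ℝ) : ℝ × ℕ := (minEntry x, x.length / 2 - (next x).length / 2)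

/-- From `(μ^{(i)}, ν^{(i)})_i` to `(μ^{(1)} + ⋯ + μ^{(i)}, ν^{(i)})_i`, the sums being shifted
by `r`. -/
def cumulate (r : ℝ) : List (ℝ × ℕ) → List (ℝ × ℕ)
  | [] => []
  | (a, n) :: t => (r + a, n) :: cumulate (r + a) t

/-- The Young diagram: `l_{s+1-i} = μ^{(1)} + ⋯ + μ^{(i)}` and `m_{s+1-i} = ν^{(i)}`. -/
def phi₁ (x : List ℝ) : List (ℝ × ℕ) := (cumulate 0 ((levels x).map block)).reverse

/-- The rigging: `J^{(s+1-i)}` is the sequence of quantum numbers of the `i`th level. -/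
def phi₂ (x : List ℝ) : List (List ℝ) := ((levels x).map quantum).reverse

/-- The map `φ = (φ₁, φ₂)`. -/
def phi (x : List ℝ) : List (ℝ × ℕ) × List (List ℝ) := (phi₁ x, phi₂ x)

end

end ContinuousKKR

namespace ContinuousKKR

noncomputable section

/-! A sequence of nonnegative reals is encoded by its partial sums, a weakly increasing list of
breakpoints. Read them as the points where a function of slope `±1`, starting at 0 with value 0 and
slope 1, changes direction: highest weight says that this function is nonnegative at its minima.

A zero entry repeats a breakpoint. After subtraction of the minimum, the elimination rules keep a
breakpoint once if its multiplicity is odd and drop it otherwise, and the quantum numbers record the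
cancelled pairs (`partialSums_next_and_quantum_eq`). A sorted list can be recovered from these two
pieces of data, and cancelling or inserting a pair does not affect nonnegativity
(`nonnegAtMinima_oddPart_iff`). Since subtracting `μ` from `2N` entries lowers the bound `L` to `L -
2Nμ`, one step matches a path with `μ > 0`, a nonempty sorted list `J` in `[0, L - 2Nμ]` and a path
with `N - |J|` pairs of entries for the new bound (`next_quantum_of_mem_PathsN`, `eq_of_next_eq`,
`exists_next_eq`).

Iteration yields the recursive conditions `RiggedBlocks`. On the side of diagrams, a step cuts off
the columns up to the shortest row length; the boxes cut off so far are those counted by the sum of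
minima in the vacancy number, so the same recursion holds (`shiftedRigged_cons_iff`). -/

/-! ### Breakpoints: partial sums and their inverse. -/

/-- The partial sums `p + y_1, p + y_1 + y_2, …`. -/
def partialSums (p : ℝ) : List ℝ → List ℝ
  | [] => []
  | a :: y => (p + a) :: partialSums (p + a) y

/-- The list with partial sums `s`, starting from `p`. -/
def differences (p : ℝ) : List ℝ → List ℝ
  | [] => []
  | a :: s => (a - p) :: differences a s

/-- Cancels pairs of equal neighbours: in a sorted list, the entries of odd multiplicity remain,
once each. -/
def oddPart : List ℝ → List ℝ
  | [] => []
  | [a] => [a]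
  | a :: b :: t => if a = b then oddPart t else a :: oddPart (b :: t)

/-- One representative of every pair cancelled by `oddPart`. -/
def pairPart : List ℝ → List ℝ
  | [] => []
  | [_] => []
  | a :: b :: t => if a = b then a :: pairPart t else pairPart (b :: t)

/-- Consider the function with slope `±1` that changes the sign of its slope at the points of `s`.
With `up = true` it currently equals `u + t` at `t`, with `up = false` it equals `u - t`.  The
predicate says that the function is nonnegative wherever its slope changes from `-1` to `1` and
that its slope is finally `1`. -/
def NonnegAtMinima : Bool → ℝ → List ℝ → Prop
  | true, _, [] => True
  | false, _, [] => False
  | true, u, b :: t => NonnegAtMinima false (u + 2 * b) t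
  | false, u, b :: t => b ≤ u ∧ NonnegAtMinima true (u - 2 * b) t

theorem partialSums_differences (s : List ℝ) (p : ℝ) : partialSums p (differences p s) = s := by
  induction s generalizing p with
  | nil => rfl
  | cons a s ih => simp [partialSums, differences, ih]

theorem differences_partialSums (y : List ℝ) (p : ℝ) : differences p (partialSums p y) = y := by
  induction y generalizing p with
  | nil => rfl
  | cons a s ih => simp [partialSums, differences, ih]

theorem partialSums_injective (p : ℝ) : Function.Injective (partialSums p) :=
  Function.LeftInverse.injective (g := differences p) fun y => differences_partialSums y p

theorem length_partialSums (y : List ℝ) (p : ℝ) : (partialSums p y).length = y.length := by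
  induction y generalizing p with
  | nil => rfl
  | cons a s ih => simp [partialSums, ih]

/-- Neighbouring breakpoints differ by an entry, so order relations between them become sign
conditions; used for `≤` and `<`. -/
theorem isChain_partialSums (R S : ℝ → ℝ → Prop) (hRS : ∀ p a, R p (p + a) ↔ S 0 a)
    (y : List ℝ) (p : ℝ) : (p :: partialSums p y).IsChain R ↔ ∀ a ∈ y, S 0 a := by
  induction y generalizing p with
  | nil => simp [partialSums]
  | cons a y ih => simp [partialSums, List.isChain_cons_cons, ih, hRS]

theorem pairwise_partialSums_le_iff (y : List ℝ) (p : ℝ) :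
    (p :: partialSums p y).Pairwise (· ≤ ·) ↔ ∀ a ∈ y, 0 ≤ a := by
  rw [← List.isChain_iff_pairwise, isChain_partialSums _ (· ≤ ·) (by simp)]

theorem pairwise_partialSums_lt_iff (y : List ℝ) (p : ℝ) :
    (p :: partialSums p y).Pairwise (· < ·) ↔ ∀ a ∈ y, 0 < a := by
  rw [← List.isChain_iff_pairwise, isChain_partialSums _ (· < ·) (by simp)]

theorem partialSums_le_iff (y : List ℝ) (p M : ℝ) (hy : ∀ a ∈ y, 0 ≤ a) :
    (∀ r ∈ p :: partialSums p y, r ≤ M) ↔ p + y.sum ≤ M := by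
  induction y generalizing p with
  | nil => simp [partialSums]
  | cons a y ih =>
    have ha : 0 ≤ a := hy a (by simp)
    have ih' := ih (p + a) fun b hb => hy b (by simp [hb])
    rw [partialSums, List.forall_mem_cons, ih', List.sum_cons, ← add_assoc]
    have : 0 ≤ y.sum := List.sum_nonneg fun b hb => hy b (by simp [hb])
    constructor
    · exact fun h => h.2
    · exact fun h => ⟨by linarith, h⟩

theorem partialSums_replicate_append (n : ℕ) (p : ℝ) (y : List ℝ) :
    partialSums p (List.replicate n 0 ++ y) = List.replicate n p ++ partialSums p y := by
  induction n with
  | zero => simp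
  | succ n ih => simp [List.replicate_succ, partialSums, ih]

/-! ### Splitting a sorted list into odd multiplicities and pairs. -/

theorem oddPart_sublist (s : List ℝ) : (oddPart s).Sublist s := by
  induction s using oddPart.induct with
  | case1 => simp [oddPart]
  | case2 a => simp [oddPart]
  | case3 b t ih => simpa [oddPart] using (ih.cons b).cons b
  | case4 a b t h ih => simpa [oddPart, h] using ih

theorem pairPart_sublist (s : List ℝ) : (pairPart s).Sublist s := by
  induction s using pairPart.induct with
  | case1 => simp [pairPart]
  | case2 a => simp [pairPart]
  | case3 b t ih => simpa [pairPart] using ih.cons b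
  | case4 a b t h ih => simpa [pairPart, h] using ih.cons a

theorem perm_oddPart_append_pairPart (s : List ℝ) :
    s.Perm (oddPart s ++ (pairPart s ++ pairPart s)) := by
  rw [List.perm_iff_count]
  intro r
  induction s using oddPart.induct with
  | case1 => simp [pairPart, oddPart]
  | case2 a => simp [pairPart, oddPart]
  | case3 b t ih =>
    simp only [pairPart, oddPart, List.count_append, List.count_cons, if_true] at ih ⊢
    omega
  | case4 a b t h ih =>
    simp only [pairPart, oddPart, List.count_append, if_neg h] at ih ⊢
    rw [List.count_cons, List.count_cons (a := r) (b := a), ih]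
    omega

theorem pairwise_oddPart (s : List ℝ) (hs : s.Pairwise (· ≤ ·)) :
    (oddPart s).Pairwise (· < ·) := by
  induction s using oddPart.induct with
  | case1 => simp [oddPart]
  | case2 a => simp [oddPart]
  | case3 b t ih =>
    simpa [oddPart] using ih (hs.sublist ((List.sublist_cons_self b t).cons b))
  | case4 a b t h ih =>
    rw [oddPart, if_neg h, List.pairwise_cons]
    have hbt := (List.pairwise_cons.1 hs).2
    have hab : a < b := lt_of_le_of_ne ((List.pairwise_cons.1 hs).1 b (by simp)) h
    refine ⟨fun c hc => ?_, ih hbt⟩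
    rcases List.mem_cons.1 ((oddPart_sublist _).subset hc) with rfl | hc
    · exact hab
    · exact hab.trans_le ((List.pairwise_cons.1 hbt).1 c hc)

/-- A sorted list is determined by its entries of odd multiplicity and its pairs. -/
theorem eq_of_oddPart_eq_of_pairPart_eq {s t : List ℝ} (hs : s.Pairwise (· ≤ ·))
    (ht : t.Pairwise (· ≤ ·)) (h₁ : oddPart s = oddPart t) (h₂ : pairPart s = pairPart t) :
    s = t := by
  refine List.Perm.eq_of_pairwise' hs ht ((perm_oddPart_append_pairPart s).trans ?_)
  rw [h₁, h₂]
  exact (perm_oddPart_append_pairPart t).symm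

/-- Sorting `B` together with two copies of `J` works: multiplicities in `B` are at most one, so
parity separates `B` from the pairs. -/
theorem exists_oddPart_eq_pairPart_eq {B J : List ℝ} (hB : B.Pairwise (· < ·))
    (hJ : J.Pairwise (· ≤ ·)) :
    ∃ s : List ℝ, s.Pairwise (· ≤ ·) ∧ s.Perm (B ++ (J ++ J)) ∧ oddPart s = B ∧
      pairPart s = J := by
  set s := (B ++ (J ++ J)).insertionSort (· ≤ ·) with hs
  have hsort : s.Pairwise (· ≤ ·) := List.pairwise_insertionSort _ _
  have hperm : s.Perm (B ++ (J ++ J)) := List.perm_insertionSort _ _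
  have hodd := pairwise_oddPart s hsort
  have hcount (r : ℝ) : (oddPart s).count r = B.count r ∧ (pairPart s).count r = J.count r := by
    have h := (perm_oddPart_append_pairPart s).symm.trans hperm
    have h := List.perm_iff_count.1 h r
    simp only [List.count_append] at h
    have h₁ := List.nodup_iff_count_le_one.1 (hodd.imp ne_of_lt) r
    have h₂ := List.nodup_iff_count_le_one.1 (hB.imp ne_of_lt) r
    -- Both odd parts have counts at most 1, so the equation `o + 2p = b + 2j` forces `o = b` and `p
    -- = j`.
    omega
  refine ⟨s, hsort, hperm, ?_, ?_⟩
  · exact List.Perm.eq_of_pairwise' (hodd.imp le_of_lt) (hB.imp le_of_lt)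
      (List.perm_iff_count.2 fun r => (hcount r).1)
  · exact List.Perm.eq_of_pairwise' (hsort.sublist (pairPart_sublist s)) hJ
      (List.perm_iff_count.2 fun r => (hcount r).2)

theorem pairPart_eq_nil_of_nodup {s : List ℝ} (hs : s.Nodup) : pairPart s = [] := by
  refine List.eq_nil_iff_forall_not_mem.2 fun r hr => ?_
  have h := List.perm_iff_count.1 (perm_oddPart_append_pairPart s) r
  simp only [List.count_append] at h
  have h₁ := List.nodup_iff_count_le_one.1 hs r
  have h₂ := List.count_pos_iff.2 hr
  omega

theorem oddPart_replicate_append (n : ℕ) (p : ℝ) (s : List ℝ) (hs : p ∉ s) :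
    oddPart (List.replicate n p ++ s) = if Even n then oddPart s else p :: oddPart s := by
  induction n using Nat.twoStepInduction with
  | zero => simp
  | one =>
    cases s with
    | nil => simp [oddPart]
    | cons b t =>
      have : p ≠ b := fun h => hs (by simp [h])
      simp [oddPart, this]
  | more n ih _ => simp [List.replicate_succ, oddPart, ih, Nat.even_add_one]

theorem pairPart_replicate_append (n : ℕ) (p : ℝ) (s : List ℝ) (hs : p ∉ s) :
    pairPart (List.replicate n p ++ s) = List.replicate (n / 2) p ++ pairPart s := by
  induction n using Nat.twoStepInduction with
  | zero => simp
  | one =>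
    cases s with
    | nil => simp [pairPart]
    | cons b t =>
      have : p ≠ b := fun h => hs (by simp [h])
      simp [pairPart, this]
  | more n ih _ =>
    rw [show (n + 2) / 2 = n / 2 + 1 by omega]
    simp [List.replicate_succ, pairPart, ih]

/-! ### The highest weight condition as nonnegativity at minima. -/

/-- Cancelling pairs of breakpoints does not affect nonnegativity. -/
theorem nonnegAtMinima_oddPart_iff (s : List ℝ) (p : ℝ) (hs : (p :: s).Pairwise (· ≤ ·)) :
    (∀ u, 0 ≤ u + p → (NonnegAtMinima true u (oddPart s) ↔ NonnegAtMinima true u s)) ∧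
    (∀ u, p ≤ u → (NonnegAtMinima false u (oddPart s) ↔ NonnegAtMinima false u s)) := by
  induction s using oddPart.induct generalizing p with
  | case1 => simp [oddPart]
  | case2 a => simp [oddPart]
  | case3 b t ih =>
    have hpb : p ≤ b := (List.pairwise_cons.1 hs).1 b (by simp)
    have hbt : (b :: t).Pairwise (· ≤ ·) := (List.pairwise_cons.1 (List.pairwise_cons.1 hs).2).2
    have hpt : (p :: t).Pairwise (· ≤ ·) :=
      hs.sublist (((List.sublist_cons_self b t).cons b).cons_cons p)
    obtain ⟨ih₁, ih₂⟩ := ih p hpt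
    refine ⟨fun u hu => ?_, fun u hu => ?_⟩
    -- The pair creates a minimum at `b` on a rising piece, where the value is at least the one at
    -- `p`.
    · rw [oddPart, if_pos rfl, ih₁ u hu, NonnegAtMinima, NonnegAtMinima, add_sub_cancel_right]
      exact ⟨fun h => ⟨by linarith, h⟩, fun h => h.2⟩
    · rw [oddPart, if_pos rfl, ih₂ u hu, NonnegAtMinima, NonnegAtMinima, sub_add_cancel]
      refine ⟨fun h => ⟨?_, h⟩, fun h => h.2⟩
      -- On a falling piece the value at `b` is at least that at the next minimum `c`, which exists
      -- because the final slope is 1.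
      cases t with
      | nil => exact h.elim
      | cons c t => exact ((List.pairwise_cons.1 hbt).1 c (by simp)).trans h.1
  | case4 a b t h ih =>
    have hpa : p ≤ a := (List.pairwise_cons.1 hs).1 a (by simp)
    obtain ⟨ih₁, ih₂⟩ := ih a (List.pairwise_cons.1 hs).2
    refine ⟨fun u hu => ?_, fun u hu => ?_⟩
    · rw [oddPart, if_neg h, NonnegAtMinima, NonnegAtMinima, ih₂ _ (by linarith)]
    · rw [oddPart, if_neg h, NonnegAtMinima, NonnegAtMinima]
      exact and_congr_right fun hau => ih₁ _ (by linarith)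

/-- If the first breakpoint were 0, the function would fall at once and be negative at the next one.
-/
theorem pos_of_nonnegAtMinima {s : List ℝ} (hs : s.Pairwise (· < ·)) (h0 : ∀ r ∈ s, 0 ≤ r)
    (h : NonnegAtMinima true 0 s) : ∀ r ∈ s, 0 < r := by
  match s with
  | [] => simp
  | [a] => exact h.elim
  | a :: b :: t =>
    have hab : a < b := (List.pairwise_cons.1 hs).1 b (by simp)
    have ha : 0 < a := by
      have := h.1
      linarith
    intro r hr
    rcases List.mem_cons.1 hr with rfl | hr
    · exact ha
    · exact ha.trans ((List.pairwise_cons.1 hs).1 r hr)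

theorem even_length_of_nonnegAtMinima (s : List ℝ) :
    (∀ u, NonnegAtMinima true u s → Even s.length) ∧
    (∀ u, NonnegAtMinima false u s → Odd s.length) := by
  induction s with
  | nil => exact ⟨fun _ _ => by simp, fun _ h => h.elim⟩
  | cons a t ih =>
    exact ⟨fun u h => (ih.2 _ h).add_one, fun u h => (ih.1 _ h.2).add_one⟩

/-- Here `h` is the height at position `p`, so the rising piece is `(h - p) + t`. Two entries, a
rise and a fall, end at the next minimum. -/
theorem forall_nonneg_iff_nonnegAtMinima (n : ℕ) (x : List ℝ) (hx : x.length = 2 * n) (p h : ℝ) :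
    (∀ k, 1 ≤ k → k ≤ n →
      0 ≤ h + ∑ i ∈ Finset.range k, (x.getD (2 * i) 0 - x.getD (2 * i + 1) 0)) ↔
    NonnegAtMinima true (h - p) (partialSums p x) := by
  induction n generalizing x p h with
  | zero =>
    obtain rfl : x = [] := by simpa using hx
    simp only [partialSums, NonnegAtMinima, iff_true]
    intro k h1 h2
    omega
  | succ n ih =>
    match x, hx with
    | a :: b :: t, hx =>
      have ht : t.length = 2 * n := by simp at hx; omega
      have ih' := ih t ht (p + a + b) (h + (a - b))
      simp only [partialSums, NonnegAtMinima]
      rw [show h - p + 2 * (p + a) - 2 * (p + a + b) = h + (a - b) - (p + a + b) by ring, ← ih']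
      have hsum (k : ℕ) : ∑ i ∈ Finset.range (k + 1),
          ((a :: b :: t).getD (2 * i) 0 - (a :: b :: t).getD (2 * i + 1) 0) =
          ∑ i ∈ Finset.range k, (t.getD (2 * i) 0 - t.getD (2 * i + 1) 0) + (a - b) := by
        rw [Finset.sum_range_succ']
        rfl
      constructor
      · intro H
        refine ⟨?_, fun k h1 h2 => ?_⟩
        · have := H 1 le_rfl (by omega)
          rw [hsum 0] at this
          simp at this
          linarith
        · have := H (k + 1) (by omega) (by omega)
          rw [hsum] at this
          linarith
      · rintro ⟨H1, H2⟩ k h1 h2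
        obtain ⟨k, rfl⟩ : ∃ m, k = m + 1 := ⟨k - 1, by omega⟩
        rw [hsum]
        rcases Nat.eq_zero_or_pos k with rfl | hk
        · simp
          linarith
        · have := H2 k hk (by omega)
          linarith

/-- The highest weight condition in terms of breakpoints. -/
theorem highestWeight_iff (n : ℕ) (x : List ℝ) (hx : x.length = 2 * n) :
    HighestWeight n x ↔ NonnegAtMinima true 0 (partialSums 0 x) := by
  have := forall_nonneg_iff_nonnegAtMinima n x hx 0 0
  simpa [HighestWeight] using this

/-! ### Runs of zeros as multiplicities of breakpoints. -/

/-- The sequence with the blocks `a, 0^n`. -/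
def expand : List (ℝ × ℕ) → List ℝ
  | [] => []
  | (a, n) :: t => a :: (List.replicate n 0 ++ expand t)

theorem replicate_append_expand_zeroRuns (y : List ℝ) :
    List.replicate (zeroRuns y).1 0 ++ expand (zeroRuns y).2 = y := by
  induction y with
  | nil => simp [zeroRuns, expand]
  | cons a y ih =>
    unfold zeroRuns
    split_ifs with h
    · simp [List.replicate_succ, ih, h]
    · simp [expand, ih]

theorem pos_of_mem_zeroRuns (y : List ℝ) (hy : ∀ a ∈ y, 0 ≤ a) :
    ∀ b ∈ (zeroRuns y).2, 0 < b.1 := by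
  induction y with
  | nil => simp [zeroRuns]
  | cons a y ih =>
    have ih' := ih fun c hc => hy c (by simp [hc])
    unfold zeroRuns
    split_ifs with h
    · exact ih'
    · exact List.forall_mem_cons.2 ⟨lt_of_le_of_ne (hy a (by simp)) (Ne.symm h), ih'⟩

theorem partialSums_expand_cons (p a : ℝ) (n : ℕ) (t : List (ℝ × ℕ)) :
    partialSums p (expand ((a, n) :: t)) =
      List.replicate (n + 1) (p + a) ++ partialSums (p + a) (expand t) := by
  rw [expand, partialSums, partialSums_replicate_append, List.replicate_succ, List.cons_append]

theorem lt_of_mem_partialSums_expand (t : List (ℝ × ℕ)) (ht : ∀ b ∈ t, 0 < b.1) (p : ℝ) :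
    ∀ r ∈ partialSums p (expand t), p < r := by
  induction t generalizing p with
  | nil => simp [expand, partialSums]
  | cons b t ih =>
    obtain ⟨a, n⟩ := b
    have ha : 0 < a := ht (a, n) (by simp)
    intro r hr
    rw [partialSums_expand_cons, List.mem_append] at hr
    rcases hr with hr | hr
    · rw [List.eq_of_mem_replicate hr]
      linarith
    · have := ih (fun b hb => ht b (by simp [hb])) (p + a) r hr
      linarith

theorem notMem_partialSums_expand (t : List (ℝ × ℕ)) (ht : ∀ b ∈ t, 0 < b.1) (p : ℝ) :
    p ∉ partialSums p (expand t) :=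
  fun h => lt_irrefl _ (lt_of_mem_partialSums_expand t ht p p h)

/-- The entry `a` and its `n` zeros give the breakpoint `p + a` multiplicity exactly `n + 1`. For
odd `n` it disappears, which merges the neighbouring entries or, at the right end, deletes the last
one. -/
theorem partialSums_contract (t : List (ℝ × ℕ)) (ht : ∀ b ∈ t, 0 < b.1) (p a : ℝ) (n : ℕ) :
    partialSums p (contract a n t) = oddPart (partialSums p (expand ((a, n) :: t))) := by
  rw [partialSums_expand_cons,
    oddPart_replicate_append _ _ _ (notMem_partialSums_expand t ht _)]
  simp only [Nat.even_add_one]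
  induction t generalizing p a n with
  | nil => by_cases hn : Even n <;> simp [contract, partialSums, expand, oddPart, hn]
  | cons b t ih =>
    obtain ⟨b, m⟩ := b
    have ht' : ∀ b ∈ t, 0 < b.1 := fun b hb => ht b (by simp [hb])
    rw [partialSums_expand_cons, oddPart_replicate_append _ _ _ (notMem_partialSums_expand t ht' _)]
    simp only [Nat.even_add_one]
    by_cases hn : Even n
    · simp [contract, hn, partialSums, ih ht']
    · simp [contract, hn, ih ht', add_assoc]

theorem quantumAux_eq_pairPart (t : List (ℝ × ℕ)) (ht : ∀ b ∈ t, 0 < b.1) (p : ℝ) :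
    quantumAux p t = pairPart (partialSums p (expand t)) := by
  induction t generalizing p with
  | nil => simp [quantumAux, expand, partialSums, pairPart]
  | cons b t ih =>
    obtain ⟨a, n⟩ := b
    have ht' : ∀ b ∈ t, 0 < b.1 := fun b hb => ht b (by simp [hb])
    rw [partialSums_expand_cons,
      pairPart_replicate_append _ _ _ (notMem_partialSums_expand t ht' _), quantumAux, ih ht']

theorem partialSums_eliminate (y : List ℝ) (hy : ∀ a ∈ y, 0 ≤ a) :
    partialSums 0 (eliminate y) = oddPart (partialSums 0 (expand (zeroRuns y).2)) := by
  have hpos := pos_of_mem_zeroRuns y hy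
  unfold eliminate
  split
  · next h => simp [h, partialSums, expand, oddPart]
  · next a n t h =>
    rw [h] at hpos ⊢
    exact partialSums_contract t (fun b hb => hpos b (by simp [hb])) 0 a n

theorem nonneg_of_mem_partialSums {y : List ℝ} (hy : ∀ a ∈ y, 0 ≤ a) :
    ∀ r ∈ partialSums 0 y, 0 ≤ r :=
  (List.pairwise_cons.1 ((pairwise_partialSums_le_iff y 0).2 hy)).1

/-- An odd initial run would leave 0 as a breakpoint after cancellation, contradicting
`pos_of_nonnegAtMinima`. -/
theorem even_zeroRuns_fst (y : List ℝ) (hy : ∀ a ∈ y, 0 ≤ a)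
    (h : NonnegAtMinima true 0 (partialSums 0 y)) : Even (zeroRuns y).1 := by
  by_contra hodd
  have hsort := (pairwise_partialSums_le_iff y 0).2 hy
  have hmem : (0 : ℝ) ∈ oddPart (partialSums 0 y) := by
    rw [← replicate_append_expand_zeroRuns y, partialSums_replicate_append,
      oddPart_replicate_append _ _ _ (notMem_partialSums_expand _ (pos_of_mem_zeroRuns y hy) _),
      if_neg hodd]
    simp
  refine lt_irrefl _ (pos_of_nonnegAtMinima (pairwise_oddPart _ (List.pairwise_cons.1 hsort).2)
    (fun r hr => nonneg_of_mem_partialSums hy r ((oddPart_sublist _).subset hr)) ?_ 0 hmem)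
  exact ((nonnegAtMinima_oddPart_iff _ 0 hsort).1 0 (by simp)).2 h

/-- One step of the algorithm cancels the pairs of breakpoints, and the quantum numbers are their
positions. -/
theorem partialSums_next_and_quantum_eq (x : List ℝ) (hy : ∀ a ∈ reduced x, 0 ≤ a)
    (h : NonnegAtMinima true 0 (partialSums 0 (reduced x))) :
    partialSums 0 (next x) = oddPart (partialSums 0 (reduced x)) ∧
      quantum x = pairPart (partialSums 0 (reduced x)) := by
  have hpos := pos_of_mem_zeroRuns _ hy
  have heven := even_zeroRuns_fst _ hy h
  have hnot := notMem_partialSums_expand _ hpos 0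
  have hsums : partialSums 0 (reduced x) = List.replicate (zeroRuns (reduced x)).1 0 ++
      partialSums 0 (expand (zeroRuns (reduced x)).2) := by
    rw [← partialSums_replicate_append, replicate_append_expand_zeroRuns]
  constructor
  · rw [next, partialSums_eliminate _ hy, hsums, oddPart_replicate_append _ _ _ hnot, if_pos heven]
  · rw [quantum, hsums, pairPart_replicate_append _ _ _ hnot, quantumAux_eq_pairPart _ hpos]
    -- The initial run has multiplicity `n`, not `n + 1`, at 0; evenness makes `⌈n / 2⌉` the number
    -- of pairs.
    obtain ⟨k, hk⟩ := heven
    rw [hk, show (k + k + 1) / 2 = (k + k) / 2 by omega]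

/-! ### Subtracting the smallest entry. -/

theorem minEntry_mem {x : List ℝ} (hx : x ≠ []) : minEntry x ∈ x := by
  obtain ⟨m, hm⟩ := WithTop.ne_top_iff_exists.1 (List.minimum_ne_top_of_ne_nil hx)
  have : minEntry x = m := by simp [minEntry, ← hm]
  rw [this]
  exact List.minimum_mem hm.symm

theorem minEntry_le {x : List ℝ} {a : ℝ} (ha : a ∈ x) : minEntry x ≤ a := by
  obtain ⟨m, hm⟩ := WithTop.ne_top_iff_exists.1
    (List.minimum_ne_top_of_ne_nil (List.ne_nil_of_mem ha))
  have : minEntry x = m := by simp [minEntry, ← hm]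
  rw [this]
  exact_mod_cast hm ▸ List.minimum_le_of_mem' ha

theorem reduced_nonneg (x : List ℝ) : ∀ a ∈ reduced x, 0 ≤ a := by
  intro a ha
  obtain ⟨b, hb, rfl⟩ := List.mem_map.1 ha
  exact sub_nonneg.2 (minEntry_le hb)

theorem minEntry_map_add {y : List ℝ} (hy : ∀ a ∈ y, 0 ≤ a) (h0 : (0 : ℝ) ∈ y) (μ : ℝ) :
    minEntry (y.map (· + μ)) = μ := by
  refine le_antisymm ?_ ?_
  · exact minEntry_le (List.mem_map.2 ⟨0, h0, zero_add μ⟩)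
  · have hne : y.map (· + μ) ≠ [] := by simpa using List.ne_nil_of_mem h0
    obtain ⟨b, hb, h⟩ := List.mem_map.1 (minEntry_mem hne)
    have := hy b hb
    linarith

theorem reduced_map_add {y : List ℝ} (hy : ∀ a ∈ y, 0 ≤ a) (h0 : (0 : ℝ) ∈ y) (μ : ℝ) :
    reduced (y.map (· + μ)) = y := by
  simp [reduced, minEntry_map_add hy h0, Function.comp_def]

theorem map_add_reduced (x : List ℝ) : (reduced x).map (· + minEntry x) = x := by
  simp [reduced, Function.comp_def]

theorem length_reduced (x : List ℝ) : (reduced x).length = x.length := by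
  simp [reduced]

theorem sum_map_add (y : List ℝ) (μ : ℝ) : (y.map (· + μ)).sum = y.sum + y.length * μ := by
  induction y with
  | nil => simp
  | cons a y ih =>
    simp only [List.map_cons, List.sum_cons, ih, List.length_cons]
    push_cast
    ring

theorem highestWeight_map_add (n : ℕ) (y : List ℝ) (hy : y.length = 2 * n) (μ : ℝ) :
    HighestWeight n (y.map (· + μ)) ↔ HighestWeight n y := by
  unfold HighestWeight
  refine forall_congr' fun k => forall_congr' fun _ => forall_congr' fun hk => ?_
  rw [Finset.sum_congr rfl]
  intro i hi
  have hi := Finset.mem_range.1 hi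
  -- All indices are in range, so the default 0, which the shift would not move, never occurs.
  rw [List.getD_eq_getElem _ _ (by simp; omega), List.getD_eq_getElem _ _ (by simp; omega),
    List.getD_eq_getElem _ _ (by omega), List.getD_eq_getElem _ _ (by omega)]
  simp

/-! ### One step of the algorithm and its inverse. -/

theorem mem_PathsN_iff (M : ℝ) (N : ℕ) (x : List ℝ) :
    x ∈ PathsN M N ↔ x.length = 2 * N ∧ (0 :: partialSums 0 x).Pairwise (· < ·) ∧
      (∀ r ∈ 0 :: partialSums 0 x, r ≤ M) ∧ NonnegAtMinima true 0 (partialSums 0 x) := by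
  refine and_congr_right fun hx => ?_
  rw [pairwise_partialSums_lt_iff, highestWeight_iff N x hx]
  refine and_congr_right fun hpos => ?_
  rw [partialSums_le_iff x 0 M fun a ha => (hpos a ha).le, zero_add]

/-- Breakpoints of the reduced sequence of a path. -/
theorem reduced_of_mem_PathsN {L : ℝ} {N : ℕ} {x : List ℝ} (hx : x ∈ PathsN L N) :
    (∀ r ∈ 0 :: partialSums 0 (reduced x), r ≤ L - 2 * N * minEntry x) ∧
      NonnegAtMinima true 0 (partialSums 0 (reduced x)) := by
  obtain ⟨hlen, hpos, hsum, hw⟩ := hx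
  have hlen' := (length_reduced x).trans hlen
  constructor
  · rw [partialSums_le_iff _ _ _ (reduced_nonneg x)]
    rw [← map_add_reduced x, sum_map_add, hlen'] at hsum
    push_cast at hsum
    linarith
  · rw [← highestWeight_iff N _ hlen', ← highestWeight_map_add N _ hlen' (minEntry x),
      map_add_reduced]
    exact hw

theorem next_quantum_of_mem_PathsN {L : ℝ} {N : ℕ} {x : List ℝ} (hx : x ∈ PathsN L N)
    (hN : N ≠ 0) :
    0 < minEntry x ∧ ∃ N', next x ∈ PathsN (L - 2 * N * minEntry x) N' ∧
      (quantum x).length + N' = N ∧ N' < N ∧ (quantum x).Pairwise (· ≤ ·) ∧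
      ∀ r ∈ quantum x, 0 ≤ r ∧ r ≤ L - 2 * N * minEntry x := by
  obtain ⟨hle, hnn⟩ := reduced_of_mem_PathsN hx
  have hy := reduced_nonneg x
  obtain ⟨hnext, hquant⟩ := partialSums_next_and_quantum_eq x hy hnn
  have hne : x ≠ [] := by
    rintro rfl
    have := hx.1
    simp at this
    omega
  have hsort := (pairwise_partialSums_le_iff (reduced x) 0).2 hy
  have hodd := pairwise_oddPart _ (List.pairwise_cons.1 hsort).2
  have hnn' := ((nonnegAtMinima_oddPart_iff _ 0 hsort).1 0 (by simp)).2 hnn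
  have h0 : ∀ r ∈ oddPart (partialSums 0 (reduced x)), 0 ≤ r := fun r hr =>
    nonneg_of_mem_partialSums hy r ((oddPart_sublist _).subset hr)
  obtain ⟨N', hN'⟩ := (even_length_of_nonnegAtMinima _).1 _ hnn'
  have hnextlen : (next x).length = 2 * N' := by
    rw [← length_partialSums _ 0, hnext, hN', two_mul]
  have hlt := length_next_lt x hne
  have hxlen := hx.1
  -- Counting breakpoints gives `2N = 2N' + 2|J|`.
  have hperm := (perm_oddPart_append_pairPart (partialSums 0 (reduced x))).length_eq
  rw [length_partialSums, length_reduced, List.length_append, List.length_append, ← hquant] at hperm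
  refine ⟨hx.2.1 _ (minEntry_mem hne), N', ?_, by omega, by omega, ?_, ?_⟩
  · rw [mem_PathsN_iff, hnext]
    refine ⟨hnextlen, List.pairwise_cons.2 ⟨pos_of_nonnegAtMinima hodd h0 hnn', hodd⟩, ?_, hnn'⟩
    intro r hr
    exact hle r (((oddPart_sublist _).cons_cons 0).subset hr)
  · rw [hquant]
    exact (List.pairwise_cons.1 hsort).2.sublist (pairPart_sublist _)
  · rw [hquant]
    intro r hr
    have hr' := (pairPart_sublist _).subset hr
    exact ⟨nonneg_of_mem_partialSums hy r hr', hle r (List.mem_cons_of_mem _ hr')⟩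

/-- A path is determined by its smallest entry, its quantum numbers and its successor. -/
theorem eq_of_next_eq {L L' : ℝ} {N N' : ℕ} {x x' : List ℝ} (hx : x ∈ PathsN L N)
    (hx' : x' ∈ PathsN L' N') (hmin : minEntry x = minEntry x') (hq : quantum x = quantum x')
    (hn : next x = next x') : x = x' := by
  obtain ⟨hn₁, hq₁⟩ :=
    partialSums_next_and_quantum_eq x (reduced_nonneg x) (reduced_of_mem_PathsN hx).2
  obtain ⟨hn₂, hq₂⟩ :=
    partialSums_next_and_quantum_eq x' (reduced_nonneg x') (reduced_of_mem_PathsN hx').2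
  have hsort (z : List ℝ) : (partialSums 0 (reduced z)).Pairwise (· ≤ ·) :=
    (List.pairwise_cons.1 ((pairwise_partialSums_le_iff _ 0).2 (reduced_nonneg z))).2
  have : reduced x = reduced x' := partialSums_injective 0 <|
    eq_of_oddPart_eq_of_pairPart_eq (hsort x) (hsort x') (by rw [← hn₁, ← hn₂, hn])
      (by rw [← hq₁, ← hq₂, hq])
  rw [← map_add_reduced x, this, hmin, map_add_reduced]

/-- Every admissible smallest entry, list of quantum numbers and successor come from a path. -/
theorem exists_next_eq {L μ : ℝ} {N N' : ℕ} {x' J : List ℝ} (hμ : 0 < μ)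
    (hx' : x' ∈ PathsN (L - 2 * N * μ) N') (hlen : J.length + N' = N) (hJ : J ≠ [])
    (hsort : J.Pairwise (· ≤ ·)) (hmem : ∀ r ∈ J, 0 ≤ r ∧ r ≤ L - 2 * N * μ) :
    ∃ x ∈ PathsN L N, minEntry x = μ ∧ quantum x = J ∧ next x = x' := by
  rw [mem_PathsN_iff] at hx'
  obtain ⟨hlen', hlt, hle, hnn⟩ := hx'
  obtain ⟨hpos, hlt⟩ := List.pairwise_cons.1 hlt
  obtain ⟨s, hs, hperm, hsodd, hspair⟩ := exists_oddPart_eq_pairPart_eq hlt hsort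
  have hs0 : ∀ r ∈ s, 0 ≤ r ∧ r ≤ L - 2 * N * μ := by
    intro r hr
    have := hperm.subset hr
    simp only [List.mem_append, or_self] at this
    rcases this with h | h
    · exact ⟨(hpos r h).le, hle r (by simp [h])⟩
    · exact hmem r h
  have hs' : (0 :: s).Pairwise (· ≤ ·) := List.pairwise_cons.2 ⟨fun r hr => (hs0 r hr).1, hs⟩
  set y := differences 0 s with hy
  have hys : partialSums 0 y = s := partialSums_differences s 0
  have hy0 : ∀ a ∈ y, 0 ≤ a := by
    rw [← pairwise_partialSums_le_iff y 0, hys]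
    exact hs'
  -- Without a zero entry the breakpoints would be distinct and `J` empty. The zero ensures that `μ`
  -- is the minimum after shifting.
  have hzero : (0 : ℝ) ∈ y := by
    by_contra h
    have hypos : ∀ a ∈ y, 0 < a := fun a ha =>
      lt_of_le_of_ne (hy0 a ha) fun h' => h (h' ▸ ha)
    rw [← pairwise_partialSums_lt_iff y 0, hys] at hypos
    refine hJ ?_
    rw [← hspair]
    exact pairPart_eq_nil_of_nodup ((List.pairwise_cons.1 hypos).2.imp ne_of_lt)
  have hylen : y.length = 2 * N := by
    rw [← length_partialSums y 0, hys, hperm.length_eq]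
    simp only [List.length_append, length_partialSums, hlen']
    omega
  have hsnn : NonnegAtMinima true 0 s := by
    rw [← (nonnegAtMinima_oddPart_iff s 0 hs').1 0 (by simp), hsodd]
    exact hnn
  have hred := reduced_map_add hy0 hzero μ
  have hstep := partialSums_next_and_quantum_eq (y.map (· + μ)) (by rwa [hred])
    (by rwa [hred, hys])
  rw [hred, hys, hsodd, hspair] at hstep
  refine ⟨y.map (· + μ), ⟨by simpa using hylen, ?_, ?_, ?_⟩, minEntry_map_add hy0 hzero μ,
    hstep.2, partialSums_injective 0 hstep.1⟩
  · intro a ha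
    obtain ⟨b, hb, rfl⟩ := List.mem_map.1 ha
    have := hy0 b hb
    linarith
  · have := (partialSums_le_iff y 0 (L - 2 * N * μ) hy0).1 (by
      rw [hys]
      exact List.forall_mem_cons.2 ⟨hle 0 (by simp), fun r hr => (hs0 r hr).2⟩)
    rw [sum_map_add, hylen]
    push_cast
    linarith
  · rw [highestWeight_map_add N y hylen, highestWeight_iff N y hylen, hys]
    exact hsnn

/-! ### Iteration over all levels. -/

/-- The total number of rows. -/
def rowCount (bs : List (ℝ × ℕ)) : ℕ := (bs.map Prod.snd).sum

/-- The possible outputs `(μ^{(i)}, ν^{(i)})_i`, together with the quantum numbers, of the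
algorithm: if `N` rows remain, then the quantum numbers of the current level and the paths of the
next one are bounded by `L - 2 N μ`. -/
def RiggedBlocks (L : ℝ) : List (ℝ × ℕ) → List (List ℝ) → Prop
  | [], [] => 0 ≤ L
  | b :: bs, J :: Js => 0 < b.1 ∧ 0 < b.2 ∧ (J.length = b.2 ∧ J.Pairwise (· ≤ ·) ∧
      ∀ r ∈ J, 0 ≤ r ∧ r ≤ L - 2 * (rowCount (b :: bs) : ℝ) * b.1) ∧
      RiggedBlocks (L - 2 * (rowCount (b :: bs) : ℝ) * b.1) bs Js
  | _, _ => False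

theorem levels_nil : levels [] = [] := by
  rw [levels]
  simp

theorem levels_of_ne_nil {x : List ℝ} (hx : x ≠ []) : levels x = x :: levels (next x) := by
  rw [levels]
  simp [hx]

theorem eq_nil_of_mem_PathsN_zero {L : ℝ} {x : List ℝ} (hx : x ∈ PathsN L 0) : x = [] := by
  simpa using hx.1

theorem ne_nil_of_mem_PathsN {L : ℝ} {N : ℕ} {x : List ℝ} (hx : x ∈ PathsN L N) (hN : N ≠ 0) :
    x ≠ [] := by
  rintro rfl
  have := hx.1
  simp at this
  omega

theorem riggedBlocks_of_mem_PathsN {L : ℝ} {N : ℕ} {x : List ℝ} (hx : x ∈ PathsN L N) :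
    rowCount ((levels x).map block) = N ∧
      RiggedBlocks L ((levels x).map block) ((levels x).map quantum) := by
  induction N using Nat.strong_induction_on generalizing L x with
  | _ N ih =>
    rcases eq_or_ne N 0 with rfl | hN
    · obtain rfl := eq_nil_of_mem_PathsN_zero hx
      simpa [levels_nil, rowCount, RiggedBlocks] using hx.2.2.1
    · obtain ⟨hμ, N', hnext, hlen, hlt, hsort, hmem⟩ := next_quantum_of_mem_PathsN hx hN
      obtain ⟨ih₁, ih₂⟩ := ih N' hlt hnext
      have hb : (block x).2 = (quantum x).length := by
        simp only [block, hx.1, hnext.1]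
        omega
      rw [levels_of_ne_nil (ne_nil_of_mem_PathsN hx hN), List.map_cons, List.map_cons]
      have hrow : rowCount (block x :: (levels (next x)).map block) = N := by
        rw [rowCount, List.map_cons, List.sum_cons, ← rowCount, ih₁, hb, hlen]
      refine ⟨hrow, hμ, by omega, ⟨hb.symm, hsort, ?_⟩, ?_⟩
      · rw [hrow]
        exact hmem
      · rw [hrow]
        exact ih₂

/-- The row count recovers `N`; then each step is undone by `eq_of_next_eq`. The bounds `L`, `L'`
may differ. -/
theorem eq_of_blocks_eq {L L' : ℝ} {N N' : ℕ} {x x' : List ℝ} (hx : x ∈ PathsN L N)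
    (hx' : x' ∈ PathsN L' N') (hb : (levels x).map block = (levels x').map block)
    (hq : (levels x).map quantum = (levels x').map quantum) : x = x' := by
  obtain rfl : N = N' := by
    rw [← (riggedBlocks_of_mem_PathsN hx).1, hb, (riggedBlocks_of_mem_PathsN hx').1]
  induction N using Nat.strong_induction_on generalizing L L' x x' with
  | _ N ih =>
    rcases eq_or_ne N 0 with rfl | hN
    · rw [eq_nil_of_mem_PathsN_zero hx, eq_nil_of_mem_PathsN_zero hx']
    · obtain ⟨-, M, hnext, hlen, hlt, -⟩ := next_quantum_of_mem_PathsN hx hN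
      obtain ⟨-, M', hnext', hlen', -⟩ := next_quantum_of_mem_PathsN hx' hN
      rw [levels_of_ne_nil (ne_nil_of_mem_PathsN hx hN),
        levels_of_ne_nil (ne_nil_of_mem_PathsN hx' hN)] at hb hq
      simp only [List.map_cons, List.cons.injEq] at hb hq
      obtain rfl : M = M' := by
        rw [← hq.1] at hlen'
        omega
      exact eq_of_next_eq hx hx' (congrArg Prod.fst hb.1) hq.1 (ih M hlt hnext hb.2 hq.2 hnext')

theorem exists_blocks_eq {L : ℝ} (bs : List (ℝ × ℕ)) (Js : List (List ℝ))
    (h : RiggedBlocks L bs Js) :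
    ∃ x ∈ PathsN L (rowCount bs), (levels x).map block = bs ∧ (levels x).map quantum = Js := by
  induction bs generalizing L Js with
  | nil =>
    cases Js with
    | nil =>
      refine ⟨[], ⟨rfl, by simp, h, ?_⟩, by simp [levels_nil]⟩
      intro k h1 h2
      simp only [rowCount, List.map_nil, List.sum_nil] at h2
      omega
    | cons J Js => exact h.elim
  | cons b bs ih =>
    cases Js with
    | nil => exact h.elim
    | cons J Js =>
      obtain ⟨hμ, hν, ⟨hlen, hsort, hmem⟩, h⟩ := h
      obtain ⟨x', hx', hb, hq⟩ := ih Js h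
      have hrow : J.length + rowCount bs = rowCount (b :: bs) := by
        simp [rowCount, hlen]
      have hJ : J ≠ [] := List.ne_nil_of_length_pos (hlen ▸ hν)
      obtain ⟨x, hx, hmin, hquant, hnext⟩ := exists_next_eq hμ hx' hrow hJ hsort hmem
      have hne : x ≠ [] := ne_nil_of_mem_PathsN hx (by omega)
      refine ⟨x, hx, ?_, ?_⟩
      · rw [levels_of_ne_nil hne, List.map_cons, hnext, hb]
        congr 1
        refine Prod.ext hmin ?_
        simp only [block, hx.1, hnext, hx'.1]
        omega
      · rw [levels_of_ne_nil hne, List.map_cons, hnext, hq, hquant]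

/-! ### Row lengths, area and vacancy numbers. -/

/-- The inverse of `cumulate`. -/
def decumulate (r : ℝ) : List (ℝ × ℕ) → List (ℝ × ℕ)
  | [] => []
  | (a, n) :: t => (a - r, n) :: decumulate a t

theorem cumulate_decumulate (c : List (ℝ × ℕ)) (r : ℝ) : cumulate r (decumulate r c) = c := by
  induction c generalizing r with
  | nil => rfl
  | cons b c ih => simp [cumulate, decumulate, ih]

theorem decumulate_cumulate (c : List (ℝ × ℕ)) (r : ℝ) : decumulate r (cumulate r c) = c := by
  induction c generalizing r with
  | nil => rfl
  | cons b c ih => simp [cumulate, decumulate, ih]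

theorem rowCount_cumulate (c : List (ℝ × ℕ)) (r : ℝ) : rowCount (cumulate r c) = rowCount c := by
  induction c generalizing r with
  | nil => rfl
  | cons b c ih => simpa [cumulate, rowCount] using ih (r + b.1)

/-- Rigged diagrams with rows in increasing order, all row lengths being shifted by `r`. -/
def ShiftedRigged (r L : ℝ) (c : List (ℝ × ℕ)) (Js : List (List ℝ)) : Prop :=
  (∀ b ∈ c, r < b.1 ∧ 0 < b.2) ∧ c.Pairwise (fun b d => b.1 < d.1) ∧
    (c.map fun b => (b.1 - r) * (b.2 : ℝ)).sum ≤ L / 2 ∧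
    List.Forall₂ (fun b K => K.length = b.2 ∧ K.Pairwise (· ≤ ·) ∧
      ∀ q ∈ K, 0 ≤ q ∧ q ≤ L - 2 * (c.map fun d => min (b.1 - r) (d.1 - r) * (d.2 : ℝ)).sum) c Js

theorem sum_map_sub_mul (t : List (ℝ × ℕ)) (r l : ℝ) :
    (t.map fun b => (b.1 - r) * (b.2 : ℝ)).sum =
      (t.map fun b => (b.1 - l) * (b.2 : ℝ)).sum + (rowCount t : ℝ) * (l - r) := by
  induction t with
  | nil => simp [rowCount]
  | cons b t ih =>
    simp only [rowCount, List.map_cons, List.sum_cons, Nat.cast_add] at ih ⊢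
    rw [ih]
    ring

theorem sum_map_min_sub_mul (t : List (ℝ × ℕ)) (r l a : ℝ) :
    (t.map fun d => min (a - r) (d.1 - r) * (d.2 : ℝ)).sum =
      (t.map fun d => min (a - l) (d.1 - l) * (d.2 : ℝ)).sum + (rowCount t : ℝ) * (l - r) := by
  induction t with
  | nil => simp [rowCount]
  | cons b t ih =>
    simp only [rowCount, List.map_cons, List.sum_cons, Nat.cast_add] at ih ⊢
    rw [ih, show a - r = a - l + (l - r) by ring, show b.1 - r = b.1 - l + (l - r) by ring,
      min_add_add_right]
    ring

theorem sum_map_min_eq_zero (t : List (ℝ × ℕ)) (l : ℝ) (ht : ∀ d ∈ t, l < d.1) :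
    (t.map fun d => min (l - l) (d.1 - l) * (d.2 : ℝ)).sum = 0 := by
  refine List.sum_eq_zero fun z hz => ?_
  obtain ⟨d, hd, rfl⟩ := List.mem_map.1 hz
  have := ht d hd
  rw [sub_self, min_eq_left (by linarith), zero_mul]

theorem forall₂_congr_of_mem {α β : Type*} {R S : α → β → Prop} (u : List α) (v : List β)
    (h : ∀ a ∈ u, ∀ b, R a b ↔ S a b) : List.Forall₂ R u v ↔ List.Forall₂ S u v := by
  induction u generalizing v with
  | nil => simp
  | cons a u ih =>
    cases v with
    | nil => simp
    | cons b v =>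
      rw [List.forall₂_cons, List.forall₂_cons, h a (by simp),
        ih v fun a ha => h a (by simp [ha])]

/-- The shortest rows come first, so every row crosses the columns between `r` and `b.1`. Cutting
these off removes the same area from every sum of minima, and lowering `L` by twice that area
compensates. -/
theorem shiftedRigged_cons_iff (r L : ℝ) (b : ℝ × ℕ) (t : List (ℝ × ℕ)) (J : List ℝ)
    (Js : List (List ℝ)) :
    ShiftedRigged r L (b :: t) (J :: Js) ↔
      r < b.1 ∧ 0 < b.2 ∧ (J.length = b.2 ∧ J.Pairwise (· ≤ ·) ∧
        ∀ q ∈ J, 0 ≤ q ∧ q ≤ L - 2 * (rowCount (b :: t) : ℝ) * (b.1 - r)) ∧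
      ShiftedRigged b.1 (L - 2 * (rowCount (b :: t) : ℝ) * (b.1 - r)) t Js := by
  have hrow : (rowCount (b :: t) : ℝ) = b.2 + rowCount t := by simp [rowCount]
  unfold ShiftedRigged
  rw [List.forall_mem_cons, List.pairwise_cons, List.forall₂_cons, List.map_cons, List.sum_cons,
    sum_map_sub_mul t r b.1]
  -- Both sides contain this ordering; once it is assumed, the minima involving `b` can be
  -- evaluated.
  by_cases hl : ∀ d ∈ t, b.1 < d.1
  swap
  · exact iff_of_false (fun h => hl h.2.1.1) (fun h => hl fun d hd => (h.2.2.2.1 d hd).1)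
  by_cases hr : r < b.1
  swap
  · exact iff_of_false (fun h => hr h.1.1.1) (fun h => hr h.1)
  have hfirst : L - 2 * ((b :: t).map fun d => min (b.1 - r) (d.1 - r) * (d.2 : ℝ)).sum =
      L - 2 * (rowCount (b :: t) : ℝ) * (b.1 - r) := by
    rw [List.map_cons, List.sum_cons, sum_map_min_sub_mul t r b.1, sum_map_min_eq_zero t _ hl,
      min_self, hrow]
    ring
  rw [hfirst, forall₂_congr_of_mem t Js (S := fun d K => K.length = d.2 ∧ K.Pairwise (· ≤ ·) ∧
      ∀ q ∈ K, 0 ≤ q ∧ q ≤ L - 2 * (rowCount (b :: t) : ℝ) * (b.1 - r) -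
        2 * (t.map fun e => min (d.1 - b.1) (e.1 - b.1) * (e.2 : ℝ)).sum)]
  · have harea : (b.1 - r) * (b.2 : ℝ) + ((t.map fun d => (d.1 - b.1) * (d.2 : ℝ)).sum +
        (rowCount t : ℝ) * (b.1 - r)) ≤ L / 2 ↔
        (t.map fun d => (d.1 - b.1) * (d.2 : ℝ)).sum ≤
          (L - 2 * (rowCount (b :: t) : ℝ) * (b.1 - r)) / 2 := by
      rw [hrow]
      constructor <;> intro h <;> linarith
    rw [harea]
    constructor
    · rintro ⟨⟨⟨-, h1⟩, h2⟩, ⟨-, h3⟩, h4, h5, h6⟩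
      exact ⟨hr, h1, h5, fun d hd => ⟨hl d hd, (h2 d hd).2⟩, h3, h4, h6⟩
    · rintro ⟨-, h1, h5, h2, h3, h4, h6⟩
      exact ⟨⟨⟨hr, h1⟩, fun d hd => ⟨hr.trans (hl d hd), (h2 d hd).2⟩⟩, ⟨hl, h3⟩, h4, h5, h6⟩
  · intro d hd K
    have hbd := hl d hd
    have : L - 2 * ((b :: t).map fun e => min (d.1 - r) (e.1 - r) * (e.2 : ℝ)).sum =
        L - 2 * (rowCount (b :: t) : ℝ) * (b.1 - r) -
          2 * (t.map fun e => min (d.1 - b.1) (e.1 - b.1) * (e.2 : ℝ)).sum := by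
      rw [List.map_cons, List.sum_cons, sum_map_min_sub_mul t r b.1, hrow,
        min_eq_right (by linarith)]
      ring
    rw [this]

theorem riggedBlocks_iff_shiftedRigged (bs : List (ℝ × ℕ)) (Js : List (List ℝ)) (r L : ℝ) :
    RiggedBlocks L bs Js ↔ ShiftedRigged r L (cumulate r bs) Js := by
  induction bs generalizing Js r L with
  | nil =>
    cases Js with
    | nil => simp [RiggedBlocks, ShiftedRigged, cumulate, div_nonneg_iff]
    | cons J Js => simp [RiggedBlocks, ShiftedRigged, cumulate]
  | cons b bs ih =>
    obtain ⟨a, n⟩ := b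
    cases Js with
    | nil => simp [RiggedBlocks, ShiftedRigged, cumulate]
    | cons J Js =>
      have hrow : rowCount ((r + a, n) :: cumulate (r + a) bs) = rowCount ((a, n) :: bs) := by
        have := rowCount_cumulate bs (r + a)
        simp only [rowCount, List.map_cons, List.sum_cons] at this ⊢
        rw [this]
      rw [cumulate, shiftedRigged_cons_iff, RiggedBlocks, hrow]
      simp only [add_sub_cancel_left, lt_add_iff_pos_right]
      rw [ih]

theorem mem_RiggedDiagrams_iff (L : ℝ) (c : List (ℝ × ℕ)) (Js : List (List ℝ)) :
    (c.reverse, Js.reverse) ∈ RiggedDiagrams L ↔ c ≠ [] ∧ ShiftedRigged 0 L c Js := by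
  simp only [RiggedDiagrams, Diagrams, Rig, vacancy, ShiftedRigged, Set.mem_ofPred_eq,
    List.forall₂_reverse_iff, List.map_reverse, List.sum_reverse, List.pairwise_reverse,
    List.mem_reverse, sub_zero, gt_iff_lt, Nat.one_le_iff_ne_zero,
    List.length_eq_zero_iff, List.reverse_eq_nil_iff, ne_eq, and_assoc]

/-! ### Assembling the bijection. -/

theorem levels_ne_nil_iff (x : List ℝ) : levels x ≠ [] ↔ x ≠ [] := by
  refine ⟨fun h hx => h (by rw [hx, levels_nil]), fun h => ?_⟩
  rw [levels_of_ne_nil h]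
  exact List.cons_ne_nil _ _

theorem cumulate_ne_nil_iff (r : ℝ) (c : List (ℝ × ℕ)) : cumulate r c ≠ [] ↔ c ≠ [] := by
  cases c <;> simp [cumulate]

theorem phi_mem_RiggedDiagrams_iff (L : ℝ) (x : List ℝ) :
    phi x ∈ RiggedDiagrams L ↔
      x ≠ [] ∧ RiggedBlocks L ((levels x).map block) ((levels x).map quantum) := by
  rw [phi, phi₁, phi₂, mem_RiggedDiagrams_iff, ← riggedBlocks_iff_shiftedRigged,
    cumulate_ne_nil_iff, ne_eq, List.map_eq_nil_iff, ← ne_eq, levels_ne_nil_iff]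

theorem bijOn_phi (L : ℝ) : Set.BijOn phi (Paths L) (RiggedDiagrams L) := by
  refine ⟨?_, ?_, ?_⟩
  · rintro x ⟨N, hN, hx⟩
    exact (phi_mem_RiggedDiagrams_iff L x).2
      ⟨ne_nil_of_mem_PathsN hx (by omega), (riggedBlocks_of_mem_PathsN hx).2⟩
  · rintro x ⟨N, -, hx⟩ x' ⟨N', -, hx'⟩ h
    obtain ⟨h₁, h₂⟩ := Prod.ext_iff.1 h
    refine eq_of_blocks_eq hx hx' ?_ (List.reverse_injective h₂)
    exact Function.LeftInverse.injective (fun c => decumulate_cumulate c 0)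
      (List.reverse_injective h₁)
  · rintro ⟨c, Js⟩ h
    rw [← c.reverse_reverse, ← Js.reverse_reverse, mem_RiggedDiagrams_iff,
      ← cumulate_decumulate c.reverse 0, ← riggedBlocks_iff_shiftedRigged,
      cumulate_ne_nil_iff] at h
    obtain ⟨x, hx, hb, hq⟩ := exists_blocks_eq _ _ h.2
    have hphi : phi x = (c, Js) := by
      rw [phi, phi₁, phi₂, hb, hq, cumulate_decumulate, List.reverse_reverse, List.reverse_reverse]
    refine ⟨x, ⟨_, ?_, hx⟩, hphi⟩
    -- Zero rows would mean an empty path with no levels, but the diagram is nonempty.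
    by_contra h0
    obtain rfl : x = [] := by
      have := hx.1
      exact List.length_eq_zero_iff.1 (by omega)
    rw [levels_nil] at hb
    exact h.1 hb.symm

end

end ContinuousKKR

theorem mainTheorem4 (L : ℝ) (hL : 0 < L) :
    Set.BijOn ContinuousKKR.phi (ContinuousKKR.Paths L) (ContinuousKKR.RiggedDiagrams L) := by
  exact ContinuousKKR.bijOn_phi L
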